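/- For a metric space $X$ write $(a\cdot b)_e=\frac12\bigl(d(a,e)+d(b,e)-d(a,b)\bigr)$; $X$ is hyperbolic if for some $\delta\ge 0$ one has $(a\cdot b)_e\ge\min\{(a\cdot c)_e,(b\cdot c)_e\}-\delta$ for all $e,a,b,c\in X$. The boundary $\partial X$ is the set of sequences $(a_n)$ in $X$ with $(a_m\cdot a_n)_e\to\infty$ as $m,n\to\infty$, modulo the equivalence $(a_n)\sim(b_n)$ iff $(a_m\cdot b_n)_e\to\infty$ as $m,n\to\infty$ (this does not depend on $e$). For $a,b\in\partial X$ let $(a\cdot b)_e=\sup\liminf_{m,n\to\infty}(a_m\cdot b_n)_e\in[0,\infty]$, the supremum being over all sequences $(a_m)$, $(b_n)$ representing $a$, $b$. A metric $d$ on $\partial X$ is visual if there are $r>1$, $e\in X$ and $k_1,k_2>0$ with $k_1r^{-(a\cdot b)_e}\le d(a,b)\le k_2r^{-(a\cdot b)_e}$ for all $a,b\in\partial X$ (where $r^{-\infty}=0$). **Lemma.** Let $(X,d_X)$ and $(Y,d_Y)$ be infinite proper geodesic hyperbolic metric spaces, and let $f:Y\to X$ be a proper map (not necessarily continuous), meaning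 that preimages of bounded sets are bounded. Fix $e\in Y$. Write $[x,y]$ for any geodesic from $x$ to $y$ and $B_Y(e,N)$ for the open ball. For $N\in[0,\infty)$ define, with $\inf\emptyset=\infty$, $$M(N)=\inf\{(f(x)\cdot f(y))_{f(e)} \mid x,y\in Y,\ (x\cdot y)_e\ge N\},$$ $$M'(N)=\inf\{d_X(f(e),\gamma)\mid \gamma=[f(x),f(y)]\text{ in }X\text{ for some }[x,y]\subseteq Y\smallsetminus B_Y(e,N)\},$$ $$M''(N)=\inf\{d_X(f(e),\gamma)\mid \gamma=[f(z),f(y)]\text{ in }X\text{ for some }z\text{ on some }[e,y]\text{ in }Y\text{ with }d_Y(e,z)\ge N\}.$$ The following are equivalent: (a) the induced map $\hat f:\partial Y\to\partial X$, $\lim a_n\mapsto\lim f(a_n)$, is well-defined (if $(a_n)$ represents a point of $\partial Y$, then $(f(a_n))$ represents a point of $\partial X$, which depends only on the class of $(a_n)$); (b) $\hat f$ is well-defined and is uniformly continuous with respect to any visual metrics on $\partial Y$ and $\partial X$; (c) $M(N)\to\infty$ as $N\to\infty$; (d) $M'(N)\to\infty$ as $N\to\infty$. Moreover, if $\sup\{d_X(f(x),f(y))\mid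 d_Y(x,y)\le r\}<\infty$ for all $r\ge 0$, then these are also equivalent to (e) $M''(N)\to\infty$ as $N\to\infty$. -/

import Mathlib

open Set Filter Topology
open scoped NNReal ENNReal

noncomputable section

namespace GromovBoundary

section Space

variable {X : Type*} [MetricSpace X]

/-- The Gromov product `(a · b)_e`. -/
def gromovProduct (e a b : X) : ℝ := (dist a e + dist b e - dist a b) / 2

/-- `X` is hyperbolic: it is `(δ)`-hyperbolic for some `δ ≥ 0`. -/
class IsHyperbolic (X : Type*) [MetricSpace X] : Prop where
  exists_delta : ∃ δ : ℝ, 0 ≤ δ ∧ ∀ e a b c : X,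
    min (gromovProduct e a c) (gromovProduct e b c) - δ ≤ gromovProduct e a b

/-- `γ` is (the image of) a geodesic `[x, y]` from `x` to `y`, that is, of an isometric embedding
of the interval `[0, d(x, y)]` that starts at `x` and ends at `y`. -/
def IsGeodesic (x y : X) (γ : Set X) : Prop :=
  ∃ c : ℝ → X, c 0 = x ∧ c (dist x y) = y ∧
    (∀ s ∈ Icc 0 (dist x y), ∀ t ∈ Icc 0 (dist x y), dist (c s) (c t) = |s - t|) ∧
    γ = c '' Icc 0 (dist x y)

/-- `X` is a geodesic space: any two points are joined by a geodesic. -/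
class IsGeodesicSpace (X : Type*) [MetricSpace X] : Prop where
  exists_geodesic : ∀ x y : X, ∃ γ : Set X, IsGeodesic x y γ

/-- `(a_m · b_n)_e → ∞` as `m, n → ∞`, for every base point `e`
(changing `e` changes the product by a bounded amount). -/
def SeqEquiv (a b : ℕ → X) : Prop :=
  ∀ e : X, Tendsto (fun p : ℕ × ℕ => gromovProduct e (a p.1) (b p.2)) atTop atTop

lemma gromovProduct_comm (e a b : X) : gromovProduct e a b = gromovProduct e b a := by
  unfold gromovProduct
  rw [dist_comm a b]
  ring

lemma SeqEquiv.symm {a b : ℕ → X} (h : SeqEquiv a b) : SeqEquiv b a := by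
  intro e
  have hs : Tendsto (fun p : ℕ × ℕ => p.swap) atTop atTop := by
    rw [← prod_atTop_atTop_eq]
    exact tendsto_snd.prodMk tendsto_fst
  refine ((h e).comp hs).congr fun p => ?_
  exact gromovProduct_comm _ _ _

lemma SeqEquiv.trans [IsHyperbolic X] {a b c : ℕ → X} (h : SeqEquiv a b) (h' : SeqEquiv b c) :
    SeqEquiv a c := by
  intro e
  obtain ⟨δ, -, hδ⟩ := IsHyperbolic.exists_delta (X := X)
  have h1 : Tendsto (fun p : ℕ × ℕ => (p.1, p.1)) atTop atTop := by
    rw [← prod_atTop_atTop_eq]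
    exact tendsto_fst.prodMk tendsto_fst
  have h2 := (h e).comp h1
  have h3 := h' e
  rw [tendsto_atTop] at h2 h3 ⊢
  intro R
  filter_upwards [h2 (R + δ), h3 (R + δ)] with p hp hq
  have hd := hδ e (a p.1) (c p.2) (b p.1)
  rw [gromovProduct_comm e (c p.2) (b p.1)] at hd
  have := le_min hp hq
  simp only [Function.comp_apply] at this
  linarith

/-- The sequences `(a_n)` in `X` with `(a_m · a_n)_e → ∞` as `m, n → ∞`. -/
def GromovSeq (X : Type*) [MetricSpace X] : Type _ := {a : ℕ → X // SeqEquiv a a}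

/-- Two such sequences are equivalent when `(a_m · b_n)_e → ∞` as `m, n → ∞`. -/
instance gromovSetoid (X : Type*) [MetricSpace X] [IsHyperbolic X] : Setoid (GromovSeq X) where
  r a b := SeqEquiv a.1 b.1
  iseqv := ⟨fun a => a.2, fun h => h.symm, fun h h' => h.trans h'⟩

/-- The Gromov boundary `∂X`. -/
def Boundary (X : Type*) [MetricSpace X] [IsHyperbolic X] : Type _ := Quotient (gromovSetoid X)

/-- The point `lim a_n` of the boundary. -/
def Boundary.lim [IsHyperbolic X] (a : GromovSeq X) : Boundary X := Quotient.mk _ a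

/-- The Gromov product of two boundary points: `sup liminf_{m, n → ∞} (a_m · b_n)_e` over all
sequences representing the two points, a value in `[0, ∞]`. -/
def boundaryProduct [IsHyperbolic X] (e : X) (ξ η : Boundary X) : ℝ≥0∞ :=
  ⨆ (a : GromovSeq X) (b : GromovSeq X) (_ : Boundary.lim a = ξ) (_ : Boundary.lim b = η),
    liminf (fun p : ℕ × ℕ => ENNReal.ofReal (gromovProduct e (a.1 p.1) (b.1 p.2))) atTop

/-- `r ^ (-t)` for `t ∈ [0, ∞]`, with `r ^ (-∞) = 0`. -/
def rpowNeg (r : ℝ) (t : ℝ≥0∞) : ℝ := if t = ∞ then 0 else r ^ (-t.toReal)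

/-- `d` is a visual metric on `∂X` (for some visual parameter `r > 1` and some base point). -/
def IsVisualMetric [IsHyperbolic X] (d : MetricSpace (Boundary X)) : Prop :=
  ∃ r : ℝ, 1 < r ∧ ∃ (e : X) (k₁ k₂ : ℝ), 0 < k₁ ∧ 0 < k₂ ∧ ∀ ξ η : Boundary X,
    k₁ * rpowNeg r (boundaryProduct e ξ η) ≤ d.dist ξ η ∧
    d.dist ξ η ≤ k₂ * rpowNeg r (boundaryProduct e ξ η)

end Space

section Map

variable {X Y : Type*} [MetricSpace X] [MetricSpace Y]

/-- `f` is proper: preimages of bounded sets are bounded. When `X` and `Y` are proper metric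
spaces, this holds as soon as preimages of compact sets are compact. -/
def IsMetricallyProper (f : Y → X) : Prop :=
  ∀ s : Set X, Bornology.IsBounded s → Bornology.IsBounded (f ⁻¹' s)

/-- `sup {d(f x, f y) | d(x, y) ≤ r} < ∞` for all `r ≥ 0`. -/
def IsCoarselyLipschitz (f : Y → X) : Prop :=
  ∀ r : ℝ, 0 ≤ r → BddAbove {t : ℝ | ∃ x y : Y, dist x y ≤ r ∧ t = dist (f x) (f y)}

/-- The rule `lim a_n ↦ lim f(a_n)` is a well-defined map `∂Y → ∂X`: if `(a_n)` represents a
boundary point then so does `(f(a_n))`, and the latter point depends only on `lim a_n`. -/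
structure BoundaryMapWellDefined (f : Y → X) : Prop where
  map_seq : ∀ a : ℕ → Y, SeqEquiv a a → SeqEquiv (f ∘ a) (f ∘ a)
  map_equiv : ∀ a b : ℕ → Y, SeqEquiv a a → SeqEquiv b b → SeqEquiv a b →
    SeqEquiv (f ∘ a) (f ∘ b)

/-- The induced map `∂Y → ∂X`, `lim a_n ↦ lim f(a_n)`. -/
def boundaryMap [IsHyperbolic X] [IsHyperbolic Y] (f : Y → X) (hf : BoundaryMapWellDefined f) :
    Boundary Y → Boundary X :=
  Quotient.map (fun a : GromovSeq Y => (⟨f ∘ a.1, hf.map_seq a.1 a.2⟩ : GromovSeq X))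
    (fun a b hab => hf.map_equiv a.1 b.1 a.2 b.2 hab)

/-- `M(N)`, the infimum of `(f(x) · f(y))_{f(e)}` over `x, y` with `(x · y)_e ≥ N`.
Here and below, the infimum is taken in `[0, ∞]`. -/
def mitraM (f : Y → X) (e : Y) (N : ℝ≥0) : ℝ≥0∞ :=
  ⨅ (x : Y) (y : Y) (_ : (N : ℝ) ≤ gromovProduct e x y),
    ENNReal.ofReal (gromovProduct (f e) (f x) (f y))

/-- `M'(N)`, the infimum of `d(f(e), γ)` over the geodesics `γ = [f(x), f(y)]` such that some
geodesic `[x, y]` lies outside the open ball `B(e, N)`. -/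
def mitraM' (f : Y → X) (e : Y) (N : ℝ≥0) : ℝ≥0∞ :=
  ⨅ (x : Y) (y : Y) (σ : Set Y) (γ : Set X) (_ : IsGeodesic x y σ)
    (_ : σ ⊆ (Metric.ball e (N : ℝ))ᶜ) (_ : IsGeodesic (f x) (f y) γ), Metric.infEDist (f e) γ

/-- `M''(N)`, the infimum of `d(f(e), γ)` over the geodesics `γ = [f(z), f(y)]` such that `z` lies
on some geodesic `[e, y]` and `d(e, z) ≥ N`. -/
def mitraM'' (f : Y → X) (e : Y) (N : ℝ≥0) : ℝ≥0∞ :=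
  ⨅ (y : Y) (z : Y) (σ : Set Y) (γ : Set X) (_ : IsGeodesic e y σ) (_ : z ∈ σ)
    (_ : (N : ℝ) ≤ dist e z) (_ : IsGeodesic (f z) (f y) γ), Metric.infEDist (f e) γ

/-- The induced map `∂Y → ∂X` is well-defined, and it is uniformly continuous with respect to any
visual metrics on `∂Y` and `∂X`. -/
def BoundaryMapUniformlyContinuous [IsHyperbolic X] [IsHyperbolic Y] (f : Y → X) : Prop :=
  ∃ hf : BoundaryMapWellDefined f,
    ∀ (dY : MetricSpace (Boundary Y)) (dX : MetricSpace (Boundary X)),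
      IsVisualMetric dY → IsVisualMetric dX → UniformContinuous (boundaryMap f hf)

end Map

end GromovBoundary

end

open GromovBoundary

/-! Condition (c) is the hub: it says that `f` sends pairs with large Gromov product to pairs with
large Gromov product, uniformly. In a visual metric, being close means having a large product, so
(c) gives (b), and (b) contains (a). For (a) ⇒ (c), suppose pairs with `(x_n · y_n) ≥ n` have images
of bounded product. Compactness (`exists_gromov_subseq`) lets a subsequence of the `x_n` converge to
a boundary point; the `y_n` converge to the same point, so the images would have to be equivalent, a
contradiction. For (c) ⇔ (d), the distance from a base point to a geodesic equals the product of its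
endpoints up to `2δ`. For (e), (c) is tested on pairs `z ∈ [e, y]`; conversely, `[e, x]` and `[e,
y]` stay close up to distance `(x · y)_e`, and the coarse Lipschitz bound carries this closeness to
`X`. -/

namespace GromovBoundary

/-! ### Gromov products, geodesics and compactness -/

section Products

variable {X : Type*} [MetricSpace X]

lemma gromovProduct_nonneg (e a b : X) : 0 ≤ gromovProduct e a b := by
  unfold gromovProduct
  linarith [dist_triangle_right a b e]

lemma gromovProduct_le_dist (e a b : X) : gromovProduct e a b ≤ dist a e := by
  unfold gromovProduct
  linarith [dist_triangle b a e, dist_comm a b]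

lemma gromovProduct_le_add_dist (e e' a b : X) :
    gromovProduct e a b ≤ gromovProduct e' a b + dist e e' := by
  unfold gromovProduct
  linarith [dist_triangle_right a e e', dist_triangle_right b e e']

/-- The Gromov product is a lower bound for the distance from the base point to a geodesic. -/
lemma IsGeodesic.gromovProduct_le_dist_of_mem {x y : X} {γ : Set X} (h : IsGeodesic x y γ) (e : X)
    {p : X} (hp : p ∈ γ) : gromovProduct e x y ≤ dist e p := by
  obtain ⟨c, h0, h1, hc, rfl⟩ := h
  obtain ⟨t, ht, rfl⟩ := hp
  have hx := hc 0 ⟨le_rfl, dist_nonneg⟩ t ht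
  have hy := hc t ht (dist x y) ⟨dist_nonneg, le_rfl⟩
  rw [h0, zero_sub, abs_neg, abs_of_nonneg ht.1] at hx
  rw [h1, abs_sub_comm, abs_of_nonneg (sub_nonneg.2 ht.2)] at hy
  unfold gromovProduct
  linarith [dist_triangle x (c t) e, dist_triangle_left y e (c t), dist_comm e (c t)]

/-- In a `(δ)`-hyperbolic space, a geodesic comes within `2δ` plus the Gromov product of its
endpoints of the base point. -/
lemma IsGeodesic.exists_dist_le {x y : X} {γ : Set X} (h : IsGeodesic x y γ) (e : X) {δ : ℝ}
    (hδ : ∀ e a b c : X,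
      min (gromovProduct e a c) (gromovProduct e b c) - δ ≤ gromovProduct e a b) :
    ∃ p ∈ γ, dist e p ≤ gromovProduct e x y + 2 * δ := by
  obtain ⟨c, h0, h1, hc, rfl⟩ := h
  -- With this `t`, the products of `c t` with `x` and with `y` agree, both being the mean of `(x ·
  -- y)_e` and `d(e, c t)`; hyperbolicity then bounds that mean by `(x · y)_e + δ`.
  set t : ℝ := gromovProduct x y e with ht_def
  have ht : t ∈ Icc 0 (dist x y) :=
    ⟨gromovProduct_nonneg _ _ _, (gromovProduct_le_dist x y e).trans_eq (dist_comm _ _)⟩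
  refine ⟨c t, ⟨t, ht, rfl⟩, ?_⟩
  have hx := hc 0 ⟨le_rfl, dist_nonneg⟩ t ht
  have hy := hc t ht (dist x y) ⟨dist_nonneg, le_rfl⟩
  rw [h0, zero_sub, abs_neg, abs_of_nonneg ht.1] at hx
  rw [h1, abs_sub_comm, abs_of_nonneg (sub_nonneg.2 ht.2), dist_comm] at hy
  have hp := hδ e x y (c t)
  have heq : gromovProduct e x (c t) = gromovProduct e y (c t) := by
    simp only [gromovProduct] at ht_def ⊢
    linarith [dist_comm x y, dist_comm x e, dist_comm y e]
  rw [heq, min_self] at hp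
  simp only [gromovProduct] at hp heq ⊢
  linarith [dist_comm e (c t)]

/-- A geodesic issuing from `e` has a point at each distance `t ≤ d(e, y)` from `e`. -/
lemma IsGeodesic.exists_mem_dist_eq {e y : X} {σ : Set X} (h : IsGeodesic e y σ) {t : ℝ}
    (ht : t ∈ Icc 0 (dist e y)) : ∃ z ∈ σ, dist e z = t := by
  obtain ⟨c, h0, -, hc, rfl⟩ := h
  refine ⟨c t, ⟨t, ht, rfl⟩, ?_⟩
  have := hc 0 ⟨le_rfl, dist_nonneg⟩ t ht
  rwa [h0, zero_sub, abs_neg, abs_of_nonneg ht.1] at this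

lemma IsGeodesic.gromovProduct_eq_dist {e y z : X} {σ : Set X} (h : IsGeodesic e y σ)
    (hz : z ∈ σ) : gromovProduct e z y = dist e z := by
  obtain ⟨c, h0, h1, hc, rfl⟩ := h
  obtain ⟨t, ht, rfl⟩ := hz
  have hx := hc 0 ⟨le_rfl, dist_nonneg⟩ t ht
  have hy := hc t ht (dist e y) ⟨dist_nonneg, le_rfl⟩
  rw [h0, zero_sub, abs_neg, abs_of_nonneg ht.1] at hx
  rw [h1, abs_sub_comm, abs_of_nonneg (sub_nonneg.2 ht.2)] at hy
  unfold gromovProduct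
  linarith [dist_comm e (c t), dist_comm e y]

lemma IsGeodesic.left_mem {x y : X} {γ : Set X} (h : IsGeodesic x y γ) : x ∈ γ := by
  obtain ⟨c, h0, -, -, rfl⟩ := h
  exact ⟨0, ⟨le_rfl, dist_nonneg⟩, h0⟩

/-- Two uses of hyperbolicity, through `c` and through `b`, each costing `δ`. -/
lemma min_gromovProduct_chain {δ : ℝ} (hδ : ∀ e a b c : X,
      min (gromovProduct e a c) (gromovProduct e b c) - δ ≤ gromovProduct e a b)
    (h0 : 0 ≤ δ) {e a b c d : X} {R : ℝ} (h₁ : R ≤ gromovProduct e a b)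
    (h₂ : R ≤ gromovProduct e b c) (h₃ : R ≤ gromovProduct e c d) :
    R - 2 * δ ≤ gromovProduct e a d := by
  have hac := hδ e a c b
  rw [gromovProduct_comm e c b] at hac
  have had := hδ e a d c
  rw [gromovProduct_comm e d c] at had
  have := le_min h₁ h₂
  have : R - δ ≤ min (gromovProduct e a c) (gromovProduct e c d) := le_min (by linarith)
    (by linarith)
  linarith

/-- Convergence of the Gromov products may be tested at a single base point. -/
lemma seqEquiv_of_basepoint {a b : ℕ → X} (e : X)
    (h : Tendsto (fun p : ℕ × ℕ => gromovProduct e (a p.1) (b p.2)) atTop atTop) :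
    SeqEquiv a b := fun e' =>
  tendsto_atTop_mono (fun _ => sub_le_iff_le_add.2 (gromovProduct_le_add_dist e e' _ _))
    (tendsto_atTop_add_const_right _ (-dist e e') h)

/-- In a proper geodesic hyperbolic space, every sequence going to infinity has a subsequence
representing a boundary point. -/
lemma exists_gromov_subseq [ProperSpace X] [IsGeodesicSpace X] [IsHyperbolic X] (e : X)
    (x : ℕ → X) (hx : Tendsto (fun n => dist e (x n)) atTop atTop) :
    ∃ φ : ℕ → ℕ, StrictMono φ ∧ SeqEquiv (x ∘ φ) (x ∘ φ) := by
  obtain ⟨δ, h0, hδ⟩ := IsHyperbolic.exists_delta (X := X)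
  have hpt : ∀ n k : ℕ, ∃ z : X, dist e z ≤ k ∧ ((k : ℝ) ≤ dist e (x n) →
      gromovProduct e z (x n) = k ∧ dist e z = k) := by
    intro n k
    by_cases hk : (k : ℝ) ≤ dist e (x n)
    · obtain ⟨σ, hσ⟩ := IsGeodesicSpace.exists_geodesic e (x n)
      obtain ⟨z, hz, hd⟩ := hσ.exists_mem_dist_eq ⟨k.cast_nonneg, hk⟩
      exact ⟨z, hd.le, fun _ => ⟨(hσ.gromovProduct_eq_dist hz).trans hd, hd⟩⟩
    -- The default `e` keeps all the points in the compact balls.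
    · exact ⟨e, by simp, fun h => absurd h hk⟩
  choose p hp_le hp using hpt
  -- Tychonoff replaces a diagonal argument: one subsequence makes the points at every integer
  -- distance converge.
  have hcpt : IsCompact (Set.univ.pi fun k : ℕ => Metric.closedBall e (k : ℝ)) :=
    isCompact_univ_pi fun k => isCompact_closedBall e _
  obtain ⟨q, -, φ, hφ, hlim⟩ := hcpt.tendsto_subseq (x := p) fun n k _ => by
    simpa [dist_comm] using hp_le n k
  refine ⟨φ, hφ, seqEquiv_of_basepoint e (tendsto_atTop.2 fun R => ?_)⟩
  -- The chain costs `2δ`; the two points at distance `k` are less than `2` apart, which costs `1`.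
  obtain ⟨k, hk⟩ := exists_nat_ge (R + 2 * δ + 1)
  have hnear : ∀ᶠ n in atTop, dist (p (φ n) k) (q k) < 1 :=
    (Metric.tendsto_nhds.1 (tendsto_pi_nhds.1 hlim k)) 1 one_pos
  have hfar : ∀ᶠ n in atTop, (k : ℝ) ≤ dist e (x (φ n)) :=
    (hx.comp hφ.tendsto_atTop).eventually_ge_atTop _
  have hev := hnear.and hfar
  rw [← prod_atTop_atTop_eq]
  filter_upwards [hev.prod_mk hev] with m hm
  obtain ⟨⟨hm₁, hm₂⟩, hm₃, hm₄⟩ := hm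
  obtain ⟨ha, ha'⟩ := hp _ _ hm₂
  obtain ⟨hb, hb'⟩ := hp _ _ hm₄
  have hmid : (k : ℝ) - 1 ≤ gromovProduct e (p (φ m.1) k) (p (φ m.2) k) := by
    unfold gromovProduct
    rw [dist_comm _ e, dist_comm _ e, ha', hb']
    linarith [dist_triangle_right (p (φ m.1) k) (p (φ m.2) k) (q k)]
  have := min_gromovProduct_chain hδ h0 (e := e) (a := x (φ m.1)) (d := x (φ m.2))
    (R := (k : ℝ) - 1) (by rw [gromovProduct_comm, ha]; linarith) hmid (by rw [hb]; linarith)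
  simp only [Function.comp_apply]
  linarith

end Products

/-! ### Visual metrics and products at infinity -/

section VisualMetric

variable {X : Type*} [MetricSpace X] [IsHyperbolic X]

lemma rpowNeg_pos {r : ℝ} (hr : 1 < r) {t : ℝ≥0∞} (ht : t ≠ ∞) : 0 < rpowNeg r t := by
  rw [rpowNeg, if_neg ht]
  exact Real.rpow_pos_of_pos (by linarith) _

lemma rpowNeg_antitone {r : ℝ} (hr : 1 < r) : Antitone (rpowNeg r) := by
  intro s t hst
  by_cases ht : t = ∞
  · by_cases hs : s = ∞
    · rw [hs, ht]
    · rw [ht, rpowNeg, if_pos rfl]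
      exact (rpowNeg_pos hr hs).le
  · have hs : s ≠ ∞ := ne_top_of_le_ne_top ht hst
    rw [rpowNeg, rpowNeg, if_neg ht, if_neg hs]
    exact Real.rpow_le_rpow_of_exponent_le hr.le (neg_le_neg (ENNReal.toReal_mono ht hst))

lemma exists_rpowNeg_ofReal_lt {r : ℝ} (hr : 1 < r) {ε : ℝ} (hε : 0 < ε) :
    ∃ K : ℝ, rpowNeg r (ENNReal.ofReal K) < ε := by
  obtain ⟨n, hn⟩ := exists_pow_lt_of_lt_one hε (inv_lt_one_of_one_lt₀ hr)
  refine ⟨n, ?_⟩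
  rw [rpowNeg, if_neg ENNReal.ofReal_ne_top, ENNReal.toReal_ofReal n.cast_nonneg,
    Real.rpow_neg (by linarith), Real.rpow_natCast, ← inv_pow]
  exact hn

/-- Boundary points that are close in a visual metric have a large Gromov product. -/
lemma IsVisualMetric.exists_dist_lt {d : MetricSpace (Boundary X)} (hd : IsVisualMetric d) :
    ∃ e : X, ∀ K : ℝ, ∃ ε > 0, ∀ ξ η : Boundary X,
      d.dist ξ η < ε → ENNReal.ofReal K < boundaryProduct e ξ η := by
  obtain ⟨r, hr, e, k₁, k₂, h₁, -, hv⟩ := hd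
  refine ⟨e, fun K => ⟨k₁ * rpowNeg r (ENNReal.ofReal K),
    mul_pos h₁ (rpowNeg_pos hr ENNReal.ofReal_ne_top), fun ξ η h => ?_⟩⟩
  by_contra! hle
  have := mul_le_mul_of_nonneg_left (rpowNeg_antitone hr hle) h₁.le
  linarith [(hv ξ η).1]

/-- Boundary points with a large Gromov product are close in a visual metric. -/
lemma IsVisualMetric.exists_le_boundaryProduct {d : MetricSpace (Boundary X)}
    (hd : IsVisualMetric d) :
    ∃ e : X, ∀ ε > 0, ∃ K : ℝ, ∀ ξ η : Boundary X,
      ENNReal.ofReal K ≤ boundaryProduct e ξ η → d.dist ξ η < ε := by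
  obtain ⟨r, hr, e, k₁, k₂, -, h₂, hv⟩ := hd
  refine ⟨e, fun ε hε => ?_⟩
  obtain ⟨K, hK⟩ := exists_rpowNeg_ofReal_lt hr (div_pos hε h₂)
  refine ⟨K, fun ξ η h => ?_⟩
  rw [lt_div_iff₀' h₂] at hK
  exact ((hv ξ η).2.trans
    (mul_le_mul_of_nonneg_left (rpowNeg_antitone hr h) h₂.le)).trans_lt hK

lemma exists_of_lt_boundaryProduct {e : X} {ξ η : Boundary X} {K : ℝ}
    (h : ENNReal.ofReal K < boundaryProduct e ξ η) :
    ∃ a b : GromovSeq X, Boundary.lim a = ξ ∧ Boundary.lim b = η ∧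
      ∀ᶠ p : ℕ × ℕ in atTop, K < gromovProduct e (a.1 p.1) (b.1 p.2) := by
  simp only [boundaryProduct, lt_iSup_iff] at h
  obtain ⟨a, b, ha, hb, h⟩ := h
  exact ⟨a, b, ha, hb, (eventually_lt_of_lt_liminf h).mono fun p hp =>
    lt_of_not_ge fun hle => absurd hp (ENNReal.ofReal_le_ofReal hle).not_gt⟩

lemma le_boundaryProduct {e : X} (a b : GromovSeq X) {K : ℝ}
    (h : ∀ᶠ p : ℕ × ℕ in atTop, K ≤ gromovProduct e (a.1 p.1) (b.1 p.2)) :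
    ENNReal.ofReal K ≤ boundaryProduct e (Boundary.lim a) (Boundary.lim b) := by
  refine le_trans ?_ (le_iSup₂_of_le a b (le_iSup₂_of_le rfl rfl le_rfl))
  exact le_liminf_of_le (by isBoundedDefault) (h.mono fun p hp => ENNReal.ofReal_le_ofReal hp)

end VisualMetric

/-! ### The functions `M`, `M'`, `M''` and the boundary map -/

section Map

variable {X Y : Type*} [MetricSpace X] [MetricSpace Y]

lemma tendsto_nhds_top_iff_exists_ofReal_le {g : ℝ≥0 → ℝ≥0∞} (hg : Monotone g) :
    Tendsto g atTop (𝓝 ∞) ↔ ∀ K : ℝ, ∃ N : ℝ≥0, ENNReal.ofReal K ≤ g N := by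
  rw [ENNReal.tendsto_nhds_top_iff_nnreal]
  refine ⟨fun h K => (h K.toNNReal).exists.imp fun N hN => hN.le, fun h K => ?_⟩
  obtain ⟨N, hN⟩ := h (K + 1)
  filter_upwards [eventually_ge_atTop N] with n hn
  refine lt_of_lt_of_le ?_ (hN.trans (hg hn))
  rw [ENNReal.lt_ofReal_iff_toReal_lt ENNReal.coe_ne_top]
  simp

lemma mitraM_mono (f : Y → X) (e : Y) : Monotone (mitraM f e) := fun _ _ h =>
  iInf₂_mono fun _ _ => iInf_mono' fun hN => ⟨(NNReal.coe_le_coe.2 h).trans hN, le_rfl⟩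

lemma mitraM'_mono (f : Y → X) (e : Y) : Monotone (mitraM' f e) := fun _ _ h =>
  iInf₂_mono fun _ _ => iInf₂_mono fun _ _ => iInf_mono fun _ => iInf_mono' fun hN =>
    ⟨hN.trans (compl_subset_compl.2 (Metric.ball_subset_ball (NNReal.coe_le_coe.2 h))), le_rfl⟩

lemma mitraM''_mono (f : Y → X) (e : Y) : Monotone (mitraM'' f e) := fun _ _ h =>
  iInf₂_mono fun _ _ => iInf₂_mono fun _ _ => iInf₂_mono fun _ _ => iInf_mono' fun hN =>
    ⟨(NNReal.coe_le_coe.2 h).trans hN, le_rfl⟩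

lemma ofReal_le_infEDist_iff {p : X} {γ : Set X} {K : ℝ} :
    ENNReal.ofReal K ≤ Metric.infEDist p γ ↔ ∀ q ∈ γ, K ≤ dist p q := by
  rw [Metric.le_infEDist]
  refine forall₂_congr fun q _ => ?_
  rw [edist_dist, ENNReal.ofReal_le_ofReal_iff dist_nonneg]

lemma tendsto_mitraM_iff {f : Y → X} {e : Y} :
    Tendsto (mitraM f e) atTop (𝓝 ∞) ↔ ∀ K : ℝ, ∃ N : ℝ≥0, ∀ x y : Y,
      (N : ℝ) ≤ gromovProduct e x y → K ≤ gromovProduct (f e) (f x) (f y) := by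
  rw [tendsto_nhds_top_iff_exists_ofReal_le (mitraM_mono f e)]
  simp only [mitraM, le_iInf_iff, ENNReal.ofReal_le_ofReal_iff (gromovProduct_nonneg _ _ _)]

lemma tendsto_mitraM'_iff {f : Y → X} {e : Y} :
    Tendsto (mitraM' f e) atTop (𝓝 ∞) ↔ ∀ K : ℝ, ∃ N : ℝ≥0, ∀ (x y : Y) (σ : Set Y) (γ : Set X),
      IsGeodesic x y σ → (∀ p ∈ σ, (N : ℝ) ≤ dist e p) → IsGeodesic (f x) (f y) γ →
        ∀ q ∈ γ, K ≤ dist (f e) q := by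
  rw [tendsto_nhds_top_iff_exists_ofReal_le (mitraM'_mono f e)]
  simp only [mitraM', le_iInf_iff, ofReal_le_infEDist_iff, subset_def, mem_compl_iff,
    Metric.mem_ball', not_lt]

lemma tendsto_mitraM''_iff {f : Y → X} {e : Y} :
    Tendsto (mitraM'' f e) atTop (𝓝 ∞) ↔ ∀ K : ℝ, ∃ N : ℝ≥0, ∀ (y z : Y) (σ : Set Y) (γ : Set X),
      IsGeodesic e y σ → z ∈ σ → (N : ℝ) ≤ dist e z → IsGeodesic (f z) (f y) γ →
        ∀ q ∈ γ, K ≤ dist (f e) q := by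
  rw [tendsto_nhds_top_iff_exists_ofReal_le (mitraM''_mono f e)]
  simp only [mitraM'', le_iInf_iff, ofReal_le_infEDist_iff]

lemma SeqEquiv.map_of_tendsto_mitraM {f : Y → X} {e : Y}
    (h : Tendsto (mitraM f e) atTop (𝓝 ∞)) {a b : ℕ → Y} (hab : SeqEquiv a b) :
    SeqEquiv (f ∘ a) (f ∘ b) := by
  rw [tendsto_mitraM_iff] at h
  refine seqEquiv_of_basepoint (f e) (tendsto_atTop.2 fun K => ?_)
  obtain ⟨N, hN⟩ := h K
  exact (tendsto_atTop.1 (hab e) N).mono fun p hp => hN _ _ hp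

lemma boundaryMapUniformlyContinuous_of_tendsto_mitraM [IsHyperbolic X] [IsHyperbolic Y]
    {f : Y → X} {e : Y} (h : Tendsto (mitraM f e) atTop (𝓝 ∞)) :
    BoundaryMapUniformlyContinuous f := by
  refine ⟨⟨fun a ha => ha.map_of_tendsto_mitraM h, fun a b _ _ hab => hab.map_of_tendsto_mitraM h⟩,
    fun dY dX hY hX => ?_⟩
  rw [tendsto_mitraM_iff] at h
  obtain ⟨e₁, hY⟩ := hY.exists_dist_lt
  obtain ⟨e₂, hX⟩ := hX.exists_le_boundaryProduct
  rw [Metric.uniformContinuous_iff]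
  intro ε hε
  obtain ⟨K, hK⟩ := hX ε hε
  -- The base points of the visual metrics are arbitrary; moving to `e` and from `f e` costs the
  -- distances added here and below.
  obtain ⟨N, hN⟩ := h (K + dist (f e) e₂)
  obtain ⟨ε', hε', hd⟩ := hY (N + dist e₁ e)
  refine ⟨ε', hε', fun ξ η hξη => ?_⟩
  obtain ⟨a, b, rfl, rfl, hab⟩ := exists_of_lt_boundaryProduct (hd ξ η hξη)
  refine hK _ _ (le_boundaryProduct _ _ (hab.mono fun p hp => ?_))
  have h₁ := gromovProduct_le_add_dist e₁ e (a.1 p.1) (b.1 p.2)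
  have h₂ := hN (a.1 p.1) (b.1 p.2) (by linarith)
  have h₃ := gromovProduct_le_add_dist (f e) e₂ (f (a.1 p.1)) (f (b.1 p.2))
  simp only [Function.comp_apply]
  linarith

lemma BoundaryMapWellDefined.tendsto_mitraM [ProperSpace Y] [IsGeodesicSpace Y] [IsHyperbolic Y]
    {f : Y → X} (h : BoundaryMapWellDefined f) (e : Y) :
    Tendsto (mitraM f e) atTop (𝓝 ∞) := by
  rw [tendsto_mitraM_iff]
  by_contra! hK
  obtain ⟨K, hK⟩ := hK
  choose x y hxy hf using fun n : ℕ => hK n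
  simp only [NNReal.coe_natCast] at hxy
  have hx : Tendsto (fun n => dist e (x n)) atTop atTop :=
    tendsto_atTop_mono (fun n => ((hxy n).trans (gromovProduct_le_dist _ _ _)).trans_eq
      (dist_comm _ _)) tendsto_natCast_atTop_atTop
  obtain ⟨φ, hφ, hs⟩ := exists_gromov_subseq e x hx
  have hs' : SeqEquiv (x ∘ φ) (y ∘ φ) := by
    obtain ⟨δ, -, hδ⟩ := IsHyperbolic.exists_delta (X := Y)
    refine seqEquiv_of_basepoint e (tendsto_atTop.2 fun R => ?_)
    have h₂ : Tendsto (fun p : ℕ × ℕ => ((φ p.2 : ℕ) : ℝ)) atTop atTop := by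
      rw [← prod_atTop_atTop_eq]
      exact tendsto_natCast_atTop_atTop.comp (hφ.tendsto_atTop.comp tendsto_snd)
    filter_upwards [tendsto_atTop.1 (hs e) (R + δ), tendsto_atTop.1 h₂ (R + δ)] with p hp hp'
    have := hδ e (x (φ p.1)) (y (φ p.2)) (x (φ p.2))
    rw [gromovProduct_comm e (y _)] at this
    have := le_min hp (hp'.trans (hxy _))
    simp only [Function.comp_apply] at this ⊢
    linarith
  -- No second extraction is needed: being equivalent to some sequence suffices.
  have hy : SeqEquiv (y ∘ φ) (y ∘ φ) := hs'.symm.trans hs'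
  have hdiag : Tendsto (fun n : ℕ => (n, n)) atTop atTop := by
    rw [← prod_atTop_atTop_eq]
    exact tendsto_id.prodMk tendsto_id
  have hlim := (h.map_equiv _ _ hs hy hs' (f e)).comp hdiag
  obtain ⟨n, hn⟩ := (tendsto_atTop.1 hlim K).exists
  exact absurd (hf (φ n)) (not_lt.2 hn)

lemma tendsto_mitraM'_of_tendsto_mitraM [IsHyperbolic Y] {f : Y → X} {e : Y}
    (h : Tendsto (mitraM f e) atTop (𝓝 ∞)) : Tendsto (mitraM' f e) atTop (𝓝 ∞) := by
  rw [tendsto_mitraM_iff] at h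
  rw [tendsto_mitraM'_iff]
  obtain ⟨δ, h0, hδ⟩ := IsHyperbolic.exists_delta (X := Y)
  intro K
  obtain ⟨N, hN⟩ := h K
  refine ⟨N + (2 * δ).toNNReal, fun x y σ γ hσ hfar hγ q hq =>
    le_trans (hN x y ?_) (hγ.gromovProduct_le_dist_of_mem _ hq)⟩
  obtain ⟨p, hp, hle⟩ := hσ.exists_dist_le e hδ
  have := hfar p hp
  rw [NNReal.coe_add, Real.coe_toNNReal _ (by linarith)] at this
  linarith

lemma tendsto_mitraM_of_tendsto_mitraM' [IsGeodesicSpace X] [IsGeodesicSpace Y] [IsHyperbolic X]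
    {f : Y → X} {e : Y} (h : Tendsto (mitraM' f e) atTop (𝓝 ∞)) :
    Tendsto (mitraM f e) atTop (𝓝 ∞) := by
  rw [tendsto_mitraM'_iff] at h
  rw [tendsto_mitraM_iff]
  obtain ⟨δ, -, hδ⟩ := IsHyperbolic.exists_delta (X := X)
  intro K
  obtain ⟨N, hN⟩ := h (K + 2 * δ)
  refine ⟨N, fun x y hxy => ?_⟩
  obtain ⟨σ, hσ⟩ := IsGeodesicSpace.exists_geodesic x y
  obtain ⟨γ, hγ⟩ := IsGeodesicSpace.exists_geodesic (f x) (f y)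
  obtain ⟨q, hq, hle⟩ := hγ.exists_dist_le (f e) hδ
  have := hN x y σ γ hσ (fun p hp => hxy.trans (hσ.gromovProduct_le_dist_of_mem e hp)) hγ q hq
  linarith

lemma tendsto_mitraM''_of_tendsto_mitraM {f : Y → X} {e : Y}
    (h : Tendsto (mitraM f e) atTop (𝓝 ∞)) : Tendsto (mitraM'' f e) atTop (𝓝 ∞) := by
  rw [tendsto_mitraM_iff] at h
  rw [tendsto_mitraM''_iff]
  intro K
  obtain ⟨N, hN⟩ := h K
  exact ⟨N, fun y z σ γ hσ hz hfar hγ q hq =>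
    (hN z y (hfar.trans_eq (hσ.gromovProduct_eq_dist hz).symm)).trans
      (hγ.gromovProduct_le_dist_of_mem _ hq)⟩

/-- Take `z ∈ [e, x]` and `w ∈ [e, y]` at distance `(x · y)_e` from `e`, and chain `f x`, `f z`, `f
w`, `f y`: the outer products are large by (e), the middle one because `f z`, `f w` are close
together and far from `f e`. -/
lemma tendsto_mitraM_of_tendsto_mitraM'' [IsGeodesicSpace X] [IsGeodesicSpace Y] [IsHyperbolic X]
    [IsHyperbolic Y] {f : Y → X} (hf : IsCoarselyLipschitz f) {e : Y}
    (h : Tendsto (mitraM'' f e) atTop (𝓝 ∞)) : Tendsto (mitraM f e) atTop (𝓝 ∞) := by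
  rw [tendsto_mitraM''_iff] at h
  rw [tendsto_mitraM_iff]
  obtain ⟨δ, h0, hδ⟩ := IsHyperbolic.exists_delta (X := X)
  obtain ⟨δ', h0', hδ'⟩ := IsHyperbolic.exists_delta (X := Y)
  -- With `t = (x · y)_e`, the chain `z, x, y, w` gives `(z · w)_e ≥ t - 2δ'`, so `d(z, w) = 2t -
  -- 2(z · w)_e ≤ 4δ'`.
  obtain ⟨D, hD⟩ := hf (4 * δ') (by linarith)
  have hD0 : 0 ≤ D := dist_nonneg.trans (hD ⟨e, e, by rw [dist_self]; linarith, rfl⟩)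
  intro K
  -- `2δ` pays for passing from distance to product, `2δ` for the chain in `X`, and `D` for `d(f z,
  -- f w)`.
  obtain ⟨N, hN⟩ := h (K + 4 * δ + D)
  have key : ∀ (y : Y) (t : ℝ), (N : ℝ) ≤ t → t ≤ dist e y → ∃ z, dist e z = t ∧
      gromovProduct e z y = t ∧ K + 4 * δ + D ≤ dist (f e) (f z) ∧
      K + 2 * δ ≤ gromovProduct (f e) (f z) (f y) := by
    intro y t hNt ht
    obtain ⟨σ, hσ⟩ := IsGeodesicSpace.exists_geodesic e y
    obtain ⟨z, hz, hzt⟩ := hσ.exists_mem_dist_eq ⟨N.coe_nonneg.trans hNt, ht⟩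
    obtain ⟨γ, hγ⟩ := IsGeodesicSpace.exists_geodesic (f z) (f y)
    obtain ⟨q, hq, hle⟩ := hγ.exists_dist_le (f e) hδ
    have hfar := hN y z σ γ hσ hz (hNt.trans_eq hzt.symm) hγ
    exact ⟨z, hzt, (hσ.gromovProduct_eq_dist hz).trans hzt, hfar _ hγ.left_mem,
      by linarith [hfar q hq]⟩
  refine ⟨N, fun x y hxy => ?_⟩
  obtain ⟨z, hz₁, hz₂, hz₃, hz₄⟩ := key x _ hxy
    ((gromovProduct_le_dist e x y).trans_eq (dist_comm _ _))
  obtain ⟨w, hw₁, hw₂, hw₃, hw₄⟩ := key y _ hxy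
    (((gromovProduct_comm e x y).trans_le (gromovProduct_le_dist e y x)).trans_eq (dist_comm _ _))
  have hzw := min_gromovProduct_chain hδ' h0' hz₂.ge le_rfl
    (hw₂.ge.trans_eq (gromovProduct_comm _ _ _))
  have hdzw : dist z w ≤ 4 * δ' := by
    have : gromovProduct e z w = (dist e z + dist e w - dist z w) / 2 := by
      rw [gromovProduct, dist_comm z e, dist_comm w e]
    linarith
  have hfzw : dist (f z) (f w) ≤ D := hD ⟨z, w, hdzw, rfl⟩
  have hmid : K + 2 * δ ≤ gromovProduct (f e) (f z) (f w) := by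
    rw [gromovProduct, dist_comm (f z) (f e), dist_comm (f w) (f e)]
    linarith
  have := min_gromovProduct_chain hδ h0 (hz₄.trans_eq (gromovProduct_comm _ _ _)) hmid hw₄
  linarith

end Map

end GromovBoundary


theorem lemma3p1 {X Y : Type*} [MetricSpace X] [MetricSpace Y]
    [Infinite X] [Infinite Y] [ProperSpace X] [ProperSpace Y]
    [IsGeodesicSpace X] [IsGeodesicSpace Y] [IsHyperbolic X] [IsHyperbolic Y]
    (f : Y → X) (hf : IsMetricallyProper f) (e : Y) :
    List.TFAE [
      BoundaryMapWellDefined f,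
      BoundaryMapUniformlyContinuous f,
      Tendsto (mitraM f e) atTop (𝓝 ∞),
      Tendsto (mitraM' f e) atTop (𝓝 ∞)] ∧
    (IsCoarselyLipschitz f →
      List.TFAE [
        BoundaryMapWellDefined f,
        BoundaryMapUniformlyContinuous f,
        Tendsto (mitraM f e) atTop (𝓝 ∞),
        Tendsto (mitraM' f e) atTop (𝓝 ∞),
        Tendsto (mitraM'' f e) atTop (𝓝 ∞)]) := by
  have hab : BoundaryMapUniformlyContinuous f → BoundaryMapWellDefined f := fun h => h.1
  have hac : BoundaryMapWellDefined f → Tendsto (mitraM f e) atTop (𝓝 ∞) :=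
    fun h => h.tendsto_mitraM e
  have hcb : Tendsto (mitraM f e) atTop (𝓝 ∞) → BoundaryMapUniformlyContinuous f :=
    boundaryMapUniformlyContinuous_of_tendsto_mitraM
  have hcd : Tendsto (mitraM f e) atTop (𝓝 ∞) ↔ Tendsto (mitraM' f e) atTop (𝓝 ∞) :=
    ⟨tendsto_mitraM'_of_tendsto_mitraM, tendsto_mitraM_of_tendsto_mitraM'⟩
  refine ⟨?_, fun hL => ?_⟩
  · tfae_have 2 → 1 := hab
    tfae_have 1 → 3 := hac
    tfae_have 3 → 2 := hcb
    tfae_have 3 ↔ 4 := hcd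
    tfae_finish
  · tfae_have 2 → 1 := hab
    tfae_have 1 → 3 := hac
    tfae_have 3 → 2 := hcb
    tfae_have 3 ↔ 4 := hcd
    tfae_have 3 → 5 := tendsto_mitraM''_of_tendsto_mitraM
    tfae_have 5 → 3 := tendsto_mitraM_of_tendsto_mitraM'' hL
    tfae_finish
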